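/- A skew left brace is a triple $(A,+,\circ)$ in which $(A,+)$ and $(A,\circ)$ are (not necessarily abelian) groups on the same set with $a\circ(b+c)=a\circ b-a+a\circ c$ for all $a,b,c\in A$; it is of abelian type if $(A,+)$ is abelian. Its socle is the ideal $\operatorname{Soc}(A)=\{x\in A : x\circ a=x+a \text{ and } x+a=a+x \text{ for all } a\in A\}$, so that the quotient $A/\operatorname{Soc}(A)$ is again a skew left brace. $A$ has finite multipermutation level if the sequence $S_1=A$, $S_{n+1}=S_n/\operatorname{Soc}(S_n)$ $(n\ge 1)$ reaches the zero (one-element) skew left brace. **Theorem.** Let $A$ be a skew left brace whose multiplicative group $(A,\circ)$ is isomorphic to $\mathbb{Z}$. Then $A$ has finite multipermutation level if and only if $A$ is of abelian type. -/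

import Mathlib

universe u

/-- A skew left brace `(A, +, ∘)`: two (not necessarily abelian) group structures on `A` with
`a ∘ (b + c) = a ∘ b - a + a ∘ c`. The circle operation `∘` is written `*`, so the multiplicative
group `(A, ∘)` is the `Group` structure and the additive group is the `AddGroup` structure. -/
class SkewLeftBrace (A : Type u) extends AddGroup A, Group A where
  circ_add : ∀ a b c : A, a * (b + c) = a * b - a + a * c

namespace SkewLeftBrace

section Basic

variable {A : Type u} [SkewLeftBrace A]

/-- The map `λ_a(b) = -a + a ∘ b`. -/
def lam (a b : A) : A := -a + a * b

theorem circ_eq (a b : A) : a * b = a + lam a b := by simp [lam]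

theorem circ_zero (a : A) : a * 0 = a := by
  have h := circ_add a 0 0
  rw [add_zero, sub_eq_add_neg, add_assoc] at h
  have h2 := left_eq_add.mp h
  exact (neg_add_eq_zero.mp h2).symm

theorem zero_eq_one : (0 : A) = 1 := by
  have h := circ_zero (1 : A)
  rwa [one_mul] at h

theorem lam_add (a b c : A) : lam a (b + c) = lam a b + lam a c := by
  simp only [lam, circ_add, sub_eq_add_neg, add_assoc]

theorem lam_one (b : A) : lam 1 b = b := by
  simp [lam, ← zero_eq_one (A := A)]

theorem lam_zero (a : A) : lam a 0 = 0 := by simp [lam, circ_zero]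

theorem lam_neg (a b : A) : lam a (-b) = -lam a b := by
  rw [eq_neg_iff_add_eq_zero, ← lam_add, neg_add_cancel, lam_zero]

theorem lam_circ (a b c : A) : lam (a * b) c = lam a (lam b c) := by
  have h : a * b + lam (a * b) c = a * b + lam a (lam b c) := by
    rw [← circ_eq, mul_assoc, circ_eq b c, circ_eq a (b + lam b c), lam_add, ← add_assoc,
      ← circ_eq]
  exact add_left_cancel h

theorem lam_lam_inv (a b : A) : lam a (lam a⁻¹ b) = b := by
  rw [← lam_circ, mul_inv_cancel, lam_one]

theorem lam_inv_lam (a b : A) : lam a⁻¹ (lam a b) = b := by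
  rw [← lam_circ, inv_mul_cancel, lam_one]

theorem lam_self_inv (a : A) : lam a a⁻¹ = -a := by
  simp [lam, ← zero_eq_one (A := A)]

theorem lam_inv_circ (a b : A) : lam a (a⁻¹ * b) = -a + b := by simp [lam]

end Basic

/-- An ideal of a skew left brace: a subgroup `I` of the additive group with `λ_a(I) ⊆ I` that is
normal in the additive group (`a + I = I + a`) and in the multiplicative group
(`a ∘ I = I ∘ a`). -/
structure Ideal (A : Type u) [SkewLeftBrace A] extends AddSubgroup A where
  lam_mem : ∀ (a : A) {x : A}, x ∈ carrier → lam a x ∈ carrier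
  add_conj_mem : ∀ (a : A) {x : A}, x ∈ carrier → a + x - a ∈ carrier
  circ_conj_mem : ∀ (a : A) {x : A}, x ∈ carrier → a * x * a⁻¹ ∈ carrier

namespace Ideal

variable {A : Type u} [SkewLeftBrace A] (I : Ideal A)

instance normal : I.toAddSubgroup.Normal :=
  ⟨fun x hx a => by rw [← sub_eq_add_neg]; exact I.add_conj_mem a hx⟩

/-- An ideal is also a subgroup of the multiplicative group. -/
def toSubgroup : Subgroup A where
  carrier := I.carrier
  one_mem' := by rw [← zero_eq_one]; exact I.zero_mem'
  mul_mem' := fun {x y} hx hy => by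
    rw [circ_eq]; exact I.add_mem' hx (I.lam_mem x hy)
  inv_mem' := fun {x} hx => by
    have h := I.lam_mem x⁻¹ (I.neg_mem' hx)
    rwa [← lam_self_inv, lam_inv_lam] at h

instance normal_toSubgroup : I.toSubgroup.Normal := ⟨fun _ hx a => I.circ_conj_mem a hx⟩

/-- Additive and multiplicative cosets of an ideal coincide. -/
theorem neg_add_mem_iff (a b : A) : -a + b ∈ I.toAddSubgroup ↔ a⁻¹ * b ∈ I.toSubgroup := by
  constructor
  · intro h
    have h2 := I.lam_mem a⁻¹ h
    rwa [← lam_inv_circ, lam_inv_lam] at h2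
  · intro h
    rw [← lam_inv_circ]
    exact I.lam_mem a h

/-- The underlying set of the quotient skew left brace `A / I`: the set of (additive) cosets. -/
def Factor : Type u := A ⧸ I.toAddSubgroup

/-- The projection `A → A / I`. -/
def proj (a : A) : I.Factor := QuotientAddGroup.mk a

theorem proj_eq_iff (a b : A) : I.proj a = I.proj b ↔ -a + b ∈ I.toAddSubgroup :=
  QuotientAddGroup.eq

theorem proj_eq_iff_circ (a b : A) : I.proj a = I.proj b ↔ a⁻¹ * b ∈ I.toSubgroup :=
  (I.proj_eq_iff a b).trans (I.neg_add_mem_iff a b)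

theorem proj_eq_iff_mk (a b : A) :
    I.proj a = I.proj b ↔ (QuotientGroup.mk a : A ⧸ I.toSubgroup) = QuotientGroup.mk b :=
  (I.proj_eq_iff_circ a b).trans QuotientGroup.eq.symm

theorem proj_surjective : Function.Surjective I.proj := QuotientAddGroup.mk_surjective

theorem proj_circ_congr (a b c d : A) (h₁ : I.proj a = I.proj b) (h₂ : I.proj c = I.proj d) :
    I.proj (a * c) = I.proj (b * d) := by
  rw [proj_eq_iff_mk] at *
  rw [QuotientGroup.mk_mul, QuotientGroup.mk_mul, h₁, h₂]

theorem proj_inv_congr (a b : A) (h : I.proj a = I.proj b) : I.proj a⁻¹ = I.proj b⁻¹ := by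
  rw [proj_eq_iff_mk] at *
  rw [QuotientGroup.mk_inv, QuotientGroup.mk_inv, h]

instance : AddGroup I.Factor := inferInstanceAs (AddGroup (A ⧸ I.toAddSubgroup))

instance : Mul I.Factor :=
  ⟨Quotient.map₂ (fun a b => a * b) (fun a b h₁ c d h₂ =>
    Quotient.exact (I.proj_circ_congr a b c d (Quotient.sound h₁) (Quotient.sound h₂)))⟩

instance : Inv I.Factor :=
  ⟨Quotient.map (fun a => a⁻¹) (fun a b h =>
    Quotient.exact (I.proj_inv_congr a b (Quotient.sound h)))⟩

instance : One I.Factor := ⟨I.proj 1⟩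

theorem proj_add (a b : A) : I.proj (a + b) = I.proj a + I.proj b := rfl

theorem proj_sub (a b : A) : I.proj (a - b) = I.proj a - I.proj b := rfl

theorem proj_circ (a b : A) : I.proj (a * b) = I.proj a * I.proj b := rfl

theorem proj_inv (a : A) : I.proj a⁻¹ = (I.proj a)⁻¹ := rfl

theorem proj_one : I.proj 1 = 1 := rfl

instance : Group I.Factor :=
  Group.ofLeftAxioms
    (fun x y z => by
      obtain ⟨a, rfl⟩ := I.proj_surjective x
      obtain ⟨b, rfl⟩ := I.proj_surjective y
      obtain ⟨c, rfl⟩ := I.proj_surjective z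
      simp only [← proj_circ, mul_assoc])
    (fun x => by
      obtain ⟨a, rfl⟩ := I.proj_surjective x
      rw [← proj_one, ← proj_circ, one_mul])
    (fun x => by
      obtain ⟨a, rfl⟩ := I.proj_surjective x
      rw [← proj_inv, ← proj_circ, inv_mul_cancel, proj_one])

/-- The quotient skew left brace `A / I`: both operations are induced from `A`. -/
instance : SkewLeftBrace I.Factor where
  circ_add x y z := by
    obtain ⟨a, rfl⟩ := I.proj_surjective x
    obtain ⟨b, rfl⟩ := I.proj_surjective y
    obtain ⟨c, rfl⟩ := I.proj_surjective z
    have h := congrArg I.proj (circ_add a b c)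
    exact h

end Ideal

section Socle

variable {A : Type u} [SkewLeftBrace A]

/-- `x ∘ a = x + a` and `x + a = a + x` for all `a`. -/
def InSocle (x : A) : Prop := ∀ a : A, x * a = x + a ∧ x + a = a + x

theorem InSocle.lam_eq {x : A} (hx : InSocle x) (a : A) : lam x a = a := by
  rw [lam, (hx a).1, neg_add_cancel_left]

theorem inSocle_of {x : A} (h₁ : ∀ a, lam x a = a) (h₂ : ∀ a, x + a = a + x) : InSocle x :=
  fun a => ⟨by rw [circ_eq, h₁], h₂ a⟩

theorem InSocle.lam_central {x : A} (hx : InSocle x) (a b : A) :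
    lam a x + b = b + lam a x := by
  have h := congrArg (lam a) (hx (lam a⁻¹ b)).2
  rwa [lam_add, lam_add, lam_lam_inv] at h

theorem InSocle.circ_conj_eq {x : A} (hx : InSocle x) (a : A) : a * x * a⁻¹ = lam a x := by
  rw [mul_assoc, (hx a⁻¹).1, circ_eq, lam_add, lam_self_inv, ← add_assoc,
    ← hx.lam_central a a, add_neg_cancel_right]

theorem InSocle.lam {x : A} (hx : InSocle x) (a : A) : InSocle (lam a x) := by
  refine inSocle_of (fun b => ?_) (hx.lam_central a)
  rw [← hx.circ_conj_eq a, lam_circ, lam_circ, hx.lam_eq, lam_lam_inv]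

variable (A) in
/-- The socle `Soc(A) = {x | x ∘ a = x + a and x + a = a + x for all a}`, as an ideal of `A`. -/
def socle : Ideal A where
  carrier := {x | ∀ a : A, x * a = x + a ∧ x + a = a + x}
  zero_mem' := fun a => by
    refine ⟨?_, by simp⟩
    rw [zero_add, zero_eq_one, one_mul]
  add_mem' := fun {x y} hx hy a => by
    have h : x + y = x * y := ((hx y).1).symm
    constructor
    · rw [h, mul_assoc, (hy a).1, (hx _).1, ← add_assoc, h]
    · rw [add_assoc, (hy a).2, ← add_assoc, (hx a).2, add_assoc]
  neg_mem' := fun {x} hx => by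
    change InSocle x at hx
    have h : -x = x⁻¹ := by rw [← lam_self_inv, hx.lam_eq]
    refine inSocle_of (fun a => ?_) (fun a => ?_)
    · have h2 := lam_inv_lam x a
      rwa [hx.lam_eq, ← h] at h2
    · rw [neg_add_eq_iff_eq_add, ← add_assoc, (hx a).2, add_neg_cancel_right]
  lam_mem := fun a {x} hx => InSocle.lam (x := x) hx a
  add_conj_mem := fun a {x} hx => by
    rw [← (hx a).2, add_sub_cancel_right]; exact hx
  circ_conj_mem := fun a {x} hx => by
    rw [InSocle.circ_conj_eq (x := x) hx a]; exact InSocle.lam (x := x) hx a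

end Socle

/-- A skew left brace bundled with its underlying type. -/
structure Bundled : Type (u + 1) where
  carrier : Type u
  [str : SkewLeftBrace carrier]

attribute [instance] Bundled.str

/-- `S ↦ S / Soc(S)`. -/
def Bundled.modSocle (S : Bundled.{u}) : Bundled.{u} := ⟨(socle S.carrier).Factor⟩

/-- The sequence `S_1 = A`, `S_{n+1} = S_n / Soc(S_n)`, indexed from `0`
(`socleSeq A n` is `S_{n+1}`). -/
def socleSeq (A : Type u) [SkewLeftBrace A] (n : ℕ) : Bundled.{u} := Bundled.modSocle^[n] ⟨A⟩

/-- `A` has finite multipermutation level if some `S_n` is zero, i.e. has only one element. -/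
def HasFiniteMultipermutationLevel (A : Type u) [SkewLeftBrace A] : Prop :=
  ∃ n : ℕ, Subsingleton (socleSeq A n).carrier

/-- `A` is of abelian type if its additive group is abelian. -/
def IsOfAbelianType (A : Type u) [SkewLeftBrace A] : Prop := ∀ a b : A, a + b = b + a

end SkewLeftBrace

/-!
Write `λ_a` for the additive automorphism `b ↦ -a + a ∘ b`.

Suppose `A` is of abelian type and `(A, ∘)` is generated by `g`. An endomorphism of `(A, +)`
commuting with `u = λ_g` is determined by its value at `g`, and `(u - 1)(g ^ n) = (u ^ n - 1)(g)`;
hence `1 + (u - 1) p` is a power of `u` for every `p` commuting with `u`. So `u - 1` lies in the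
Jacobson radical of `ℤ[u, u⁻¹]`, which is a Jacobson ring, and `u - 1` is nilpotent. As the kernel
of `u - 1` lies in the socle, factoring out the socle lowers the nilpotency index.

Conversely, if `A` has finite multipermutation level and `(A, ∘) ≅ ℤ`, the socle is nonzero, hence
of finite index, hence so is the center of `(A, +)`, of index `n` say. Multiplication by `n` is then
the transfer to the center, an endomorphism of `(A, +)` that kills all commutators. Its kernel is
stable under `∘`, so if it contained `c ≠ 0`, it would contain a nonzero power `x` of `c` lying in
the socle, and `x ^ n = n x = 0` contradicts torsion-freeness of `(A, ∘)`.
-/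

instance isJacobsonRing_int : IsJacobsonRing ℤ := by
  refine isJacobsonRing_iff_prime_eq.mpr fun P hP => ?_
  obtain rfl | hP0 := eq_or_ne P ⊥
  · refine eq_bot_iff.mpr fun x hx => ?_
    have hunit : IsUnit (x * (3 * x) + 1) := Ideal.mem_jacobson_bot.mp hx (3 * x)
    rw [Int.isUnit_iff] at hunit
    rw [Ideal.mem_bot]
    rcases hunit with h | h <;> nlinarith
  · have := IsPrime.to_maximal_ideal hP0
    exact Ideal.jacobson_eq_self_of_isMaximal

theorem isNilpotent_map_of_forall_exists_map_mul_eq_one {R E : Type*} [CommRing R]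
    [IsJacobsonRing R] [Ring E] (f : R →+* E) {x : R}
    (hx : ∀ r, ∃ s, f (s * (r * x + 1)) = 1) : IsNilpotent (f x) := by
  have hmem : x ∈ (RingHom.ker f).radical := by
    rw [Ideal.radical_eq_jacobson, Ideal.mem_jacobson_iff]
    intro r
    obtain ⟨s, hs⟩ := hx r
    refine ⟨s, ?_⟩
    rw [RingHom.mem_ker, map_sub, map_one, sub_eq_zero, ← hs, mul_add, mul_one, mul_assoc]
  obtain ⟨n, hn⟩ := hmem
  exact ⟨n, by rwa [RingHom.mem_ker, map_pow] at hn⟩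

open LaurentPolynomial in
theorem isNilpotent_sub_one_of_forall_commute_exists_zpow {E : Type*} [Ring E] (u : Eˣ)
    (hu : ∀ p : E, Commute ↑u p → ∃ n : ℤ, ↑(u ^ n) = p * (u - 1) + 1) :
    IsNilpotent (u - 1 : E) := by
  have : IsJacobsonRing ℤ[T;T⁻¹] := isJacobsonRing_of_finiteType (A := ℤ)
  let f : ℤ[T;T⁻¹] →ₐ[ℤ] E :=
    AddMonoidAlgebra.lift ℤ E ℤ ((Units.coeHom E).comp (zpowersHom Eˣ u))
  have hT (n : ℤ) : f (T n) = ↑(u ^ n) :=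
    (AddMonoidAlgebra.lift_single _ _ _).trans (one_smul ℤ _)
  have hf : f (T 1 - 1) = u - 1 := by rw [map_sub, hT, map_one, zpow_one]
  rw [← hf]
  refine isNilpotent_map_of_forall_exists_map_mul_eq_one f.toRingHom fun r => ?_
  have hcomm : Commute (u : E) (f r) := by
    simpa only [hT, zpow_one] using (Commute.all (T 1) r).map f
  obtain ⟨n, hn⟩ := hu (f r) hcomm
  refine ⟨T (-n), ?_⟩
  change f (T (-n) * (r * (T 1 - 1) + 1)) = 1
  rw [map_mul, map_add, map_mul, hf, map_one, ← hn, hT, ← Units.val_mul, zpow_neg, inv_mul_cancel,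
    Units.val_one]

theorem finiteIndex_of_isCyclic_of_ne_bot {G : Type*} [Group G] [IsCyclic G] {H : Subgroup G}
    (hH : H ≠ ⊥) : H.FiniteIndex := by
  let _ : CommGroup G := IsCyclic.commGroup
  obtain ⟨g, hg⟩ := IsCyclic.exists_generator (α := G)
  obtain ⟨x, hxH, hx⟩ := H.bot_or_exists_ne_one.resolve_left hH
  obtain ⟨k, rfl⟩ := hg x
  have hfin : IsOfFinOrder (g : G ⧸ H) := isOfFinOrder_iff_zpow_eq_one.mpr
    ⟨k, fun hk => hx (by simp [hk]), (QuotientGroup.eq_one_iff _).mpr hxH⟩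
  have hgen (y : G ⧸ H) : y ∈ Subgroup.zpowers (g : G ⧸ H) := by
    obtain ⟨a, rfl⟩ := QuotientGroup.mk_surjective y
    obtain ⟨m, rfl⟩ := hg a
    exact ⟨m, rfl⟩
  have := hfin.finite_zpowers
  have : Finite (G ⧸ H) := Set.finite_univ_iff.mp (this.subset fun y _ => hgen y)
  exact Subgroup.finiteIndex_of_finite_quotient

theorem nsmul_index_center_add {G : Type*} [AddGroup G] [(AddSubgroup.center G).FiniteIndex]
    (a b : G) : (AddSubgroup.center G).index • (a + b) =
      (AddSubgroup.center G).index • a + (AddSubgroup.center G).index • b := by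
  have hcenter : (AddSubgroup.center G).toSubgroup = Subgroup.center (Multiplicative G) :=
    Subgroup.ext fun x => (AddSubgroup.mem_center_iff (z := x.toAdd)).trans
      (Subgroup.mem_center_iff (G := Multiplicative G)).symm
  have : (Subgroup.center (Multiplicative G)).FiniteIndex :=
    hcenter ▸ (AddSubgroup.finiteIndex_toSubgroup_iff _).mpr ‹_›
  rw [← AddSubgroup.index_toSubgroup, hcenter]
  exact congrArg Subtype.val
    (map_mul (MonoidHom.transferCenterPow (Multiplicative G)) (.ofAdd a) (.ofAdd b))

theorem nsmul_index_center_sub_swap {G : Type*} [AddGroup G] [(AddSubgroup.center G).FiniteIndex]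
    (a b : G) : (AddSubgroup.center G).index • (a + b - (b + a)) = 0 := by
  have hcomm := (AddSubgroup.mem_center_iff.mp
    (AddSubgroup.nsmul_index_mem (AddSubgroup.center G) b)) ((AddSubgroup.center G).index • a)
  have hswap := nsmul_index_center_add (a + b - (b + a)) (b + a)
  rw [sub_add_cancel, nsmul_index_center_add, nsmul_index_center_add, hcomm] at hswap
  exact right_eq_add.mp hswap

namespace SkewLeftBrace

variable {A : Type u} [SkewLeftBrace A]

theorem Ideal.proj_eq_zero_iff (I : Ideal A) {a : A} : I.proj a = 0 ↔ a ∈ I.toAddSubgroup :=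
  QuotientAddGroup.eq_zero_iff a

variable (A) in
/-- The action of `(A, ∘)` on `(A, +)` by the maps `λ_a`. -/
def lamHom : A →* AddMonoid.End A where
  toFun a := AddMonoidHom.mk' (lam a) (lam_add a)
  map_one' := AddMonoidHom.ext lam_one
  map_mul' a b := AddMonoidHom.ext (lam_circ a b)

/-- The star operation `-a + a ∘ b - b = λ_a(b) - b`, which measures how far `a ∘ b` is from
`a + b`. -/
def starMul (a b : A) : A := lam a b - b

theorem Ideal.proj_starMul (I : Ideal A) (a b : A) :
    I.proj (starMul a b) = starMul (I.proj a) (I.proj b) := rfl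

theorem starMul_eq_zero_iff {a b : A} : starMul a b = 0 ↔ lam a b = b := sub_eq_zero

theorem IsOfAbelianType.factor (h : IsOfAbelianType A) (I : Ideal A) :
    IsOfAbelianType I.Factor := by
  intro x y
  obtain ⟨a, rfl⟩ := I.proj_surjective x
  obtain ⟨b, rfl⟩ := I.proj_surjective y
  exact congrArg I.proj (h a b)

theorem IsOfAbelianType.starMul_comm (h : IsOfAbelianType A) {a b : A} (hab : Commute a b) :
    starMul a b = starMul b a := by
  rw [starMul, starMul, lam, lam, hab.eq, sub_eq_add_neg, sub_eq_add_neg, h (-a), h (-b),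
    add_assoc, add_assoc, h (-a)]

theorem lam_zpow_eq_self {a b : A} (hab : lam a b = b) (n : ℤ) : lam (a ^ n) b = b := by
  induction n with
  | zero => rw [zpow_zero, lam_one]
  | succ n ih => rw [zpow_add_one, lam_circ, hab, ih]
  | pred n ih =>
    have hinv : lam a⁻¹ b = b := by conv_lhs => rw [← hab, lam_inv_lam]
    rw [zpow_sub_one, lam_circ, hinv, ih]

theorem IsOfAbelianType.inSocle_of_starMul_eq_zero (h : IsOfAbelianType A) {g x : A}
    (hg : ∀ a, a ∈ Subgroup.zpowers g) (hx : starMul g x = 0) : InSocle x := by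
  refine inSocle_of (fun a => ?_) (h x)
  obtain ⟨n, rfl⟩ := hg a
  obtain ⟨k, rfl⟩ := hg x
  rw [starMul_eq_zero_iff] at hx
  rw [← starMul_eq_zero_iff, h.starMul_comm ((Commute.refl g).zpow_zpow k n), starMul_eq_zero_iff]
  exact lam_zpow_eq_self hx n

theorem eq_of_commute_lamHom {g : A} (hg : ∀ a, a ∈ Subgroup.zpowers g) {p q : AddMonoid.End A}
    (hp : Commute (lamHom A g) p) (hq : Commute (lamHom A g) q) (hpq : p g = q g) : p = q := by
  have hcirc {r : AddMonoid.End A} (hr : Commute (lamHom A g) r) (a : A) :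
      r (g * a) = r g + lam g (r a) := by
    rw [circ_eq, map_add]
    exact congrArg (r g + ·) (DFunLike.congr_fun hr.eq a).symm
  have hinj : Function.Injective (lam g) := Function.LeftInverse.injective (lam_inv_lam g)
  have hiff (a : A) : p (g * a) = q (g * a) ↔ p a = q a := by
    rw [hcirc hp, hcirc hq, hpq, add_right_inj, hinj.eq_iff]
  ext a
  obtain ⟨n, rfl⟩ := Subgroup.mem_zpowers_iff.mp (hg a)
  induction n with
  | zero => simp only [zpow_zero, ← zero_eq_one, map_zero]
  | succ n ih =>
    rw [add_comm, zpow_one_add]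
    exact (hiff _).mpr ih
  | pred n ih => exact (hiff _).mp (by simpa only [← zpow_one_add, add_sub_cancel] using ih)

theorem IsOfAbelianType.exists_iterate_starMul_eq_zero (h : IsOfAbelianType A) {g : A}
    (hg : ∀ a, a ∈ Subgroup.zpowers g) : ∃ n : ℕ, ∀ a, (starMul g)^[n] a = 0 := by
  let _ : AddCommGroup A := { (inferInstance : AddGroup A) with add_comm := h }
  let u : (AddMonoid.End A)ˣ := (lamHom A).toHomUnits g
  have hu (n : ℤ) : (↑(u ^ n) : AddMonoid.End A) = lamHom A (g ^ n) := by
    rw [← map_zpow, MonoidHom.coe_toHomUnits]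
  obtain ⟨n, hn⟩ : IsNilpotent (u - 1 : AddMonoid.End A) := by
    refine isNilpotent_sub_one_of_forall_commute_exists_zpow u fun p hp => ?_
    obtain ⟨n, hn : g ^ n = p g⟩ := hg (p g)
    have hpu : Commute (u : AddMonoid.End A) (p * (u - 1) + 1) :=
      (hp.mul_right ((Commute.refl _).sub_right (Commute.one_right _))).add_right
        (Commute.one_right _)
    have hun : Commute (lamHom A g) (↑(u ^ n) : AddMonoid.End A) := by
      rw [hu]
      exact (Commute.self_zpow g n).map (lamHom A)
    have hcomm : starMul g (p g) = (p * (u - 1)) g :=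
      DFunLike.congr_fun (hp.sub_left (Commute.one_left p)).eq g
    refine ⟨n, eq_of_commute_lamHom hg hun hpu ?_⟩
    calc (↑(u ^ n) : AddMonoid.End A) g
      _ = starMul (g ^ n) g + g := by rw [hu, starMul, sub_add_cancel]; rfl
      _ = starMul g (p g) + g := by rw [← hn, h.starMul_comm (Commute.self_zpow g n)]
      _ = (p * (u - 1) + 1) g := by rw [hcomm]; rfl
  refine ⟨n, fun a => ?_⟩
  calc (starMul g)^[n] a
    _ = ((u - 1 : AddMonoid.End A) ^ n) a :=
      (congrFun (AddMonoid.End.coe_pow A (u - 1) n) a).symm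
    _ = 0 := DFunLike.congr_fun hn a

theorem HasFiniteMultipermutationLevel.of_factor_socle
    (h : HasFiniteMultipermutationLevel (socle A).Factor) : HasFiniteMultipermutationLevel A :=
  let ⟨n, hn⟩ := h
  ⟨n + 1, hn⟩

theorem IsOfAbelianType.hasFiniteMultipermutationLevel_of_iterate_starMul_eq_zero {n : ℕ} :
    ∀ {A : Type u} [SkewLeftBrace A], IsOfAbelianType A → ∀ {g : A},
      (∀ a, a ∈ Subgroup.zpowers g) → (∀ a, (starMul g)^[n] a = 0) →
        HasFiniteMultipermutationLevel A := by
  induction n with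
  | zero =>
    intro A _ _ g _ hzero
    exact ⟨0, ⟨fun a b => (hzero a).trans (hzero b).symm⟩⟩
  | succ n ih =>
    intro A _ h g hg hzero
    refine .of_factor_socle (ih (h.factor _) (g := (socle A).proj g) ?_ ?_)
    · intro x
      obtain ⟨a, rfl⟩ := (socle A).proj_surjective x
      obtain ⟨k, rfl⟩ := hg a
      exact ⟨k, (map_zpow (MonoidHom.mk' (socle A).proj (socle A).proj_circ) g k).symm⟩
    · intro x
      obtain ⟨a, rfl⟩ := (socle A).proj_surjective x
      have hsocle : InSocle ((starMul g)^[n] a) := h.inSocle_of_starMul_eq_zero hg <| by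
        rw [← Function.iterate_succ_apply' (starMul g), hzero]
      have hsemiconj : Function.Semiconj (socle A).proj (starMul g) (starMul ((socle A).proj g)) :=
        (socle A).proj_starMul g
      rw [← hsemiconj.iterate_right n a]
      exact (socle A).proj_eq_zero_iff.mpr hsocle

theorem IsOfAbelianType.hasFiniteMultipermutationLevel [IsCyclic A] (h : IsOfAbelianType A) :
    HasFiniteMultipermutationLevel A := by
  obtain ⟨g, hg⟩ := IsCyclic.exists_generator (α := A)
  obtain ⟨n, hn⟩ := h.exists_iterate_starMul_eq_zero hg
  exact h.hasFiniteMultipermutationLevel_of_iterate_starMul_eq_zero hg hn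

theorem HasFiniteMultipermutationLevel.exists_inSocle_ne_zero [Nontrivial A]
    (h : HasFiniteMultipermutationLevel A) : ∃ x : A, InSocle x ∧ x ≠ 0 := by
  obtain ⟨n, hn⟩ := h
  induction n generalizing A with
  | zero => exact absurd hn (not_subsingleton A)
  | succ n ih =>
    by_contra! hsocle
    have hinj : Function.Injective (socle A).proj := fun a b hab =>
      neg_add_eq_zero.mp (hsocle _ (((socle A).proj_eq_iff a b).mp hab))
    have := hinj.nontrivial
    obtain ⟨y, hy, hy0⟩ := ih (A := (socle A).Factor) hn
    obtain ⟨x, rfl⟩ := (socle A).proj_surjective y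
    have hx : InSocle x := fun a => ⟨hinj (hy (Ideal.proj _ a)).1, hinj (hy (Ideal.proj _ a)).2⟩
    exact hy0 (((socle A).proj_eq_zero_iff).mpr hx)

theorem Ideal.index_toSubgroup (I : Ideal A) : I.toSubgroup.index = I.toAddSubgroup.index :=
  Nat.card_congr (Quotient.congrRight fun a b => by
    rw [QuotientGroup.leftRel_apply, QuotientAddGroup.leftRel_apply]
    exact (I.neg_add_mem_iff a b).symm)

theorem InSocle.pow_eq_nsmul {x : A} (hx : InSocle x) (n : ℕ) : x ^ n = n • x := by
  induction n with
  | zero => rw [pow_zero, zero_nsmul, zero_eq_one]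
  | succ n ih => rw [pow_succ', (hx _).1, ih, succ_nsmul']

theorem nsmul_pow_eq_zero {n : ℕ} (hadd : ∀ a b : A, n • (a + b) = n • a + n • b) {c : A}
    (hc : n • c = 0) (m : ℕ) : n • c ^ m = 0 := by
  induction m with
  | zero => rw [pow_zero, ← zero_eq_one, nsmul_zero]
  | succ m ih =>
    have hlam : n • lam c (c ^ m) = lam c (n • c ^ m) := (map_nsmul (lamHom A c) n (c ^ m)).symm
    rw [pow_succ', circ_eq, hadd, hc, zero_add, hlam, ih, lam_zero]

theorem eq_zero_of_nsmul_eq_zero [IsMulTorsionFree A] [(socle A).toSubgroup.FiniteIndex] {n : ℕ}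
    (hn : n ≠ 0) (hadd : ∀ a b : A, n • (a + b) = n • a + n • b) {c : A} (hc : n • c = 0) :
    c = 0 := by
  let m := (socle A).toSubgroup.index
  have hsocle : InSocle (c ^ m) := (socle A).toSubgroup.pow_index_mem c
  have hpow : (c ^ m) ^ n = 1 := by
    rw [hsocle.pow_eq_nsmul, nsmul_pow_eq_zero hadd hc, zero_eq_one]
  rw [zero_eq_one]
  exact (pow_eq_one_iff_left Subgroup.FiniteIndex.index_ne_zero).mp
    ((pow_eq_one_iff_left hn).mp hpow)

theorem isOfAbelianType_of_finiteIndex_socle [IsMulTorsionFree A]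
    [(socle A).toSubgroup.FiniteIndex] : IsOfAbelianType A := by
  have : (socle A).toAddSubgroup.FiniteIndex :=
    ⟨(socle A).index_toSubgroup ▸ Subgroup.FiniteIndex.index_ne_zero⟩
  have hcenter : (socle A).toAddSubgroup ≤ AddSubgroup.center A := fun x hx =>
    AddSubgroup.mem_center_iff.mpr fun a => (hx a).2.symm
  have : (AddSubgroup.center A).FiniteIndex := AddSubgroup.finiteIndex_of_le hcenter
  intro a b
  exact sub_eq_zero.mp (eq_zero_of_nsmul_eq_zero AddSubgroup.FiniteIndex.index_ne_zero
    nsmul_index_center_add (nsmul_index_center_sub_swap a b))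

theorem HasFiniteMultipermutationLevel.isOfAbelianType [IsCyclic A] [IsMulTorsionFree A]
    (h : HasFiniteMultipermutationLevel A) : IsOfAbelianType A := by
  cases subsingleton_or_nontrivial A
  · exact fun a b => Subsingleton.elim _ _
  · obtain ⟨x, hx, hx0⟩ := h.exists_inSocle_ne_zero
    have hne : (socle A).toSubgroup ≠ ⊥ := fun hbot =>
      hx0 (((Subgroup.eq_bot_iff_forall _).mp hbot x hx).trans zero_eq_one.symm)
    have := finiteIndex_of_isCyclic_of_ne_bot hne
    exact isOfAbelianType_of_finiteIndex_socle

end SkewLeftBrace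

theorem mainTheorem6 {A : Type u} [SkewLeftBrace A] (hA : Nonempty (A ≃* Multiplicative ℤ)) :
    SkewLeftBrace.HasFiniteMultipermutationLevel A ↔ SkewLeftBrace.IsOfAbelianType A := by
  obtain ⟨e⟩ := hA
  have : IsCyclic A := isCyclic_of_surjective e.symm e.symm.surjective
  have : IsMulTorsionFree A := Function.Injective.isMulTorsionFree e.toMonoidHom e.injective
  exact ⟨fun h => h.isOfAbelianType, fun h => h.hasFiniteMultipermutationLevel⟩
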